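/- **Theorem 3.5.** Let $\mathscr H$ be a complex separable Hilbert space, and let $A,B,X$ be bounded linear operators on $\mathscr H$ with $A,B$ positive (i.e. $A,B\ge 0$). Let $|||\cdot|||$ be a unitarily invariant norm, that is, a norm on a two-sided ideal $\mathfrak J$ of $\mathbb B(\mathscr H)$ with $|||USV|||=|||S|||$ for all $S\in\mathfrak J$ and all unitaries $U,V$. Assume that $X\in\mathfrak J$; if $|||\cdot|||$ is lower semicontinuous on $\mathfrak J$ with respect to the operator norm (as are the norms given by symmetric gauge functions), it is enough to assume that $A^{\nu}XB^{1-\nu}+A^{1-\nu}XB^{\nu}\in\mathfrak J$ for all $\nu\in(0,1)$. Put $$F(\nu)=|||A^{\nu}XB^{1-\nu}+A^{1-\nu}XB^{\nu}|||,$$ $$T_t(a,b)=\tfrac12\Big(F\big(\tfrac{1+t}{2}a+\tfrac{1-t}{2}b\big)+F\big(\tfrac{1-t}{2}a+\tfrac{1+t}{2}b\big)\Big).$$ Then for every $\mu\in(0,1)$ the function $F$ is integrable between $\mu$ and $1-\mu$, and there exists $\xi\in(0,1)$ (depending on $A,B,X,|||\cdot|||$ and $\mu$) such that $$2|||A^{1/2}XB^{1/2}|||\le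 T_{\eta}(\mu,1-\mu)\le T_{\xi}(\mu,1-\mu)=\frac{1}{1-2\mu}\int_{\mu}^{1-\mu}F(x)\,dx\le T_{\lambda}(\mu,1-\mu)\le F(\mu)$$ for all $\eta\in[0,\xi]$ and all $\lambda\in[\xi,1]$. For $\mu=\tfrac12$ the average $\frac{1}{1-2\mu}\int_{\mu}^{1-\mu}F(x)\,dx$ is read as its limiting value $F(\tfrac12)$. -/

import Mathlib

open MeasureTheory Set Topology

noncomputable section

/-- A unitarily invariant norm on the bounded operators of a complex Hilbert space: a norm
`norm` on an associated two-sided ideal `ideal` of `𝔹(H)`, unchanged under multiplication by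
unitaries on either side.  The values of `norm` outside of `ideal` carry no meaning.
(Since the ring is a unital algebra, a two-sided ideal is automatically a complex subspace;
non-negativity of the norm follows from the axioms below.) -/
structure UnitarilyInvariantNorm (H : Type*) [NormedAddCommGroup H] [InnerProductSpace ℂ H]
    [CompleteSpace H] where
  /-- the norm ideal -/
  ideal : TwoSidedIdeal (H →L[ℂ] H)
  /-- the norm -/
  norm : (H →L[ℂ] H) → ℝ
  norm_add_le : ∀ S ∈ ideal, ∀ T ∈ ideal, norm (S + T) ≤ norm S + norm T
  norm_smul : ∀ (c : ℂ), ∀ S ∈ ideal, norm (c • S) = ‖c‖ * norm S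
  eq_zero_of_norm_eq_zero : ∀ S ∈ ideal, norm S = 0 → S = 0
  norm_unitary_mul_mul_unitary : ∀ U ∈ unitary (H →L[ℂ] H), ∀ V ∈ unitary (H →L[ℂ] H),
    ∀ S ∈ ideal, norm (U * S * V) = norm S

/-- The operator `A^ν X B^(1-ν) + A^(1-ν) X B^ν`; the powers of the positive operators
`A` and `B` are those of the continuous functional calculus. -/
def heinzOperator {H : Type*} [NormedAddCommGroup H] [InnerProductSpace ℂ H] [CompleteSpace H]
    (A B X : H →L[ℂ] H) (ν : ℝ) : H →L[ℂ] H :=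
  A ^ ν * X * B ^ (1 - ν) + A ^ (1 - ν) * X * B ^ ν

/-- `F(ν) = |||A^ν X B^(1-ν) + A^(1-ν) X B^ν|||`. -/
def heinzNorm {H : Type*} [NormedAddCommGroup H] [InnerProductSpace ℂ H] [CompleteSpace H]
    (N : UnitarilyInvariantNorm H) (A B X : H →L[ℂ] H) (ν : ℝ) : ℝ :=
  N.norm (heinzOperator A B X ν)

/-- `T_t(a,b) = (F((1+t)/2 a + (1-t)/2 b) + F((1-t)/2 a + (1+t)/2 b)) / 2`. -/
def mapT (F : ℝ → ℝ) (t a b : ℝ) : ℝ :=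
  1 / 2 * (F ((1 + t) / 2 * a + (1 - t) / 2 * b) + F ((1 - t) / 2 * a + (1 + t) / 2 * b))

/-- The average `1/(b-a) ∫_a^b F(x) dx`, understood as its limiting value `F(a)` if `a = b`. -/
def intervalMean (F : ℝ → ℝ) (a b : ℝ) : ℝ :=
  if a = b then F a else 1 / (b - a) * ∫ x in a..b, F x

end

/-! The function `F` is symmetric about 1/2, so `T_t(μ, 1 - μ)` is just `F` at `1/2 + t (μ - 1/2)`.
Once `F` is convex on (0,1), this is nondecreasing in `t ∈ [0,1]`, and its mean over [0,1] is the
integral average, which is attained at an interior `ξ` (`hermiteHadamard_of_symm`). The real content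
is the convexity of `F`.

For invertible `A`, `B`, put `Z = heinzOperator A B X x`. The operators at `x + t` and `x - t` add
up to `A^t Z B^(-t) + A^(-t) Z B^t`, so it suffices that this has norm at least `2|||Z||| - o(t^2)`.
Let `δ Z = a Z - Z b` with `a`, `b` selfadjoint. Since `iδ` generates a group of isometries, `1 +
iδ` and `1 - iδ` do not decrease the norm, nor does their product `1 + δ²`. With `A^t = 1 + t a` and
`B^t = 1 + t b`, the sum above equals `2Z + t² δ² Y` with `Y = A^(-t) Z B^(-t)` close to `Z`
(`two_mul_norm_sub_le`).

Positive `A`, `B` are reached through `A + δ`, `B + δ` when `X` is in the ideal. Otherwise `X` is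
compressed by resolvent cut-offs, and lower semicontinuity controls the limit. -/

/-! ### Convex functions on an interval and the Hermite–Hadamard inequality -/

/-- A continuous function whose second symmetric differences are bounded below by `-o(t ^ 2)` at
every point is convex. -/
theorem convexOn_Ioo_of_second_difference {a b : ℝ} {f : ℝ → ℝ} (hf : ContinuousOn f (Ioo a b))
    (h : ∀ x ∈ Ioo a b, ∀ ε > 0, ∀ᶠ t in 𝓝[>] (0 : ℝ), 2 * f x - ε * t ^ 2 ≤ f (x + t) + f (x - t)) :
    ConvexOn ℝ (Ioo a b) f := by
  refine LinearOrder.convexOn_of_lt (convex_Ioo a b) fun x hx y hy hxy c d hc hd hcd => ?_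
  simp only [smul_eq_mul]
  by_contra! hlt
  set z := c * x + d * y with hz
  have hzx : 0 < z - x := by
    have : z - x = d * (y - x) := by rw [hz, ← sub_eq_zero]; linear_combination x * hcd
    rw [this]; exact mul_pos hd (sub_pos.2 hxy)
  have hyz : 0 < y - z := by
    have : y - z = c * (y - x) := by rw [hz, ← sub_eq_zero]; linear_combination -y * hcd
    rw [this]; exact mul_pos hc (sub_pos.2 hxy)
  have hyx : y - x ≠ 0 := (sub_pos.2 hxy).ne'
  set k := (f y - f x) / (y - x) with hk
  have hky : k * (y - x) = f y - f x := div_mul_cancel₀ _ hyx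
  set p := f z - (f x + k * (z - x)) with hp
  have hp0 : 0 < p := by
    have : c * f x + d * f y = f x + k * (z - x) := by
      have : z - x = d * (y - x) := by rw [hz, ← sub_eq_zero]; linear_combination x * hcd
      rw [this]; linear_combination f x * hcd - d * hky
    rw [hp]; linarith
  -- This `ε` lets the parabola below use up exactly half of the gap `p` at `z`. Hence `g z = p / 2
  -- > 0` while `g` vanishes at `x` and `y`, and its maximum is interior. There the parabola adds `2
  -- ε t²` to a second difference that is at least `-ε t²`, contradicting maximality.
  set ε := p / (2 * ((z - x) * (y - z))) with hε
  have hε0 : 0 < ε := by positivity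
  set g : ℝ → ℝ := fun t => f t - (f x + k * (t - x)) - ε * ((t - x) * (y - t)) with hg
  have hsub : Icc x y ⊆ Ioo a b := fun t ht => ⟨hx.1.trans_le ht.1, ht.2.trans_lt hy.2⟩
  have hgc : ContinuousOn g (Icc x y) := ((hf.mono hsub).sub (by fun_prop)).sub (by fun_prop)
  obtain ⟨m, hm, hmax⟩ := isCompact_Icc.exists_isMaxOn ⟨x, left_mem_Icc.2 hxy.le⟩ hgc
  have hgz : 0 < g z := by
    have : ε * ((z - x) * (y - z)) = p / 2 := by rw [hε]; field_simp
    simp only [hg, this]; rw [← hp]; linarith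
  have hgm : 0 < g m := hgz.trans_le (hmax ⟨by linarith, by linarith⟩)
  have hxm : x < m := hm.1.lt_of_ne fun e => by
    subst e; simp [hg] at hgm
  have hmy : m < y := hm.2.lt_of_ne fun e => by
    subst e; simp [hg, hky] at hgm
  have hev : ∀ᶠ t in 𝓝[>] (0 : ℝ), t ∈ Ioo 0 (min (m - x) (y - m)) :=
    Ioo_mem_nhdsGT (lt_min (sub_pos.2 hxm) (sub_pos.2 hmy))
  obtain ⟨t, ht, hft⟩ := (hev.and (h m (hsub hm) ε hε0)).exists
  have h1 := ht.2.trans_le (min_le_left _ _)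
  have h2 := ht.2.trans_le (min_le_right _ _)
  have h3 : g (m + t) ≤ g m := hmax ⟨by linarith [ht.1], by linarith⟩
  have h4 : g (m - t) ≤ g m := hmax ⟨by linarith, by linarith [ht.1]⟩
  simp only [hg] at h3 h4
  have : 0 < ε * t ^ 2 := mul_pos hε0 (pow_pos ht.1 2)
  nlinarith

/-- A pointwise limit of convex functions is convex. -/
theorem ConvexOn.of_tendsto {ι : Type*} {l : Filter ι} [l.NeBot] {s : Set ℝ} {f : ι → ℝ → ℝ}
    {g : ℝ → ℝ} (hs : Convex ℝ s) (hf : ∀ᶠ i in l, ConvexOn ℝ s (f i))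
    (h : ∀ x ∈ s, Filter.Tendsto (fun i => f i x) l (𝓝 (g x))) : ConvexOn ℝ s g := by
  refine ⟨hs, fun x hx y hy a b ha hb hab => ?_⟩
  refine le_of_tendsto_of_tendsto (h _ (hs hx hy ha hb hab))
    (((h x hx).const_smul a).add ((h y hy).const_smul b)) ?_
  filter_upwards [hf] with i hi using hi.2 hx hy ha hb hab

/-- The two nodes are exchanged by `x ↦ 1 - x`, so both terms agree. -/
theorem mapT_eq {F : ℝ → ℝ} (hsymm : ∀ x, F (1 - x) = F x) (t μ : ℝ) :
    mapT F t μ (1 - μ) = F (1 / 2 + t * (μ - 1 / 2)) := by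
  have h1 : (1 + t) / 2 * μ + (1 - t) / 2 * (1 - μ) = 1 / 2 + t * (μ - 1 / 2) := by ring
  have h2 : (1 - t) / 2 * μ + (1 + t) / 2 * (1 - μ) = 1 - (1 / 2 + t * (μ - 1 / 2)) := by ring
  rw [mapT, h1, h2, hsymm]; ring

/-- Symmetry folds the interval onto its half between `μ` and 1/2, which is then rescaled to [0,1].
-/
theorem intervalMean_eq {F : ℝ → ℝ} (hsymm : ∀ x, F (1 - x) = F x) {μ : ℝ} (hμ : μ ≠ 1 / 2)
    (hint : IntervalIntegrable F volume μ (1 / 2)) :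
    intervalMean F μ (1 - μ) = ∫ t in (0 : ℝ)..1, F (1 / 2 + t * (μ - 1 / 2)) := by
  have hd : μ - 1 / 2 ≠ 0 := sub_ne_zero.2 hμ
  have hne : μ ≠ 1 - μ := fun h => hμ (by linarith)
  have hsub : ∫ x in (1 / 2)..(1 - μ), F x = ∫ x in μ..(1 / 2), F x := by
    have := intervalIntegral.integral_comp_sub_left (a := μ) (b := 1 / 2) F 1
    simp only [hsymm] at this
    rw [this]; norm_num
  have hint' : IntervalIntegrable F volume (1 / 2) (1 - μ) := by
    have := (hint.comp_sub_left 1).symm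
    simp only [hsymm] at this
    convert this using 1
    norm_num
  have hscale := intervalIntegral.integral_comp_add_mul (a := 0) (b := 1) F hd (1 / 2)
  have e : ∀ t : ℝ, F (1 / 2 + t * (μ - 1 / 2)) = F (1 / 2 + (μ - 1 / 2) * t) := fun t => by
    rw [mul_comm]
  simp only [e, hscale]
  rw [intervalMean, if_neg hne, ← intervalIntegral.integral_add_adjacent_intervals hint hint', hsub,
    mul_zero, add_zero, mul_one, add_sub_cancel, intervalIntegral.integral_symm (1 / 2) μ,
    smul_eq_mul]
  rw [show 1 - μ - μ = -2 * (μ - 1 / 2) by ring]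
  generalize μ - 1 / 2 = d at hd ⊢
  field_simp
  ring

/-- The refined Hermite--Hadamard inequality on a symmetric interval. -/
theorem hermiteHadamard_of_symm {F : ℝ → ℝ} (hF : ConvexOn ℝ (Ioo 0 1) F)
    (hsymm : ∀ x, F (1 - x) = F x) {μ : ℝ} (hμ : μ ∈ Ioo (0 : ℝ) 1) :
    IntervalIntegrable F volume μ (1 - μ) ∧
    ∃ ξ ∈ Ioo (0 : ℝ) 1, mapT F ξ μ (1 - μ) = intervalMean F μ (1 - μ) ∧
      ∀ η ∈ Icc 0 ξ, ∀ l ∈ Icc ξ 1,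
        F (1 / 2) ≤ mapT F η μ (1 - μ) ∧
        mapT F η μ (1 - μ) ≤ mapT F ξ μ (1 - μ) ∧
        mapT F ξ μ (1 - μ) ≤ mapT F l μ (1 - μ) ∧
        mapT F l μ (1 - μ) ≤ F μ := by
  have hcont : ContinuousOn F (Ioo 0 1) := hF.continuousOn isOpen_Ioo
  obtain ⟨-, hF2⟩ := id hF
  have hμ' : 1 - μ ∈ Ioo (0 : ℝ) 1 := ⟨by linarith [hμ.2], by linarith [hμ.1]⟩
  have hint : ∀ x ∈ Ioo (0 : ℝ) 1, IntervalIntegrable F volume μ x := fun x hx =>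
    (hcont.mono (ordConnected_Ioo.uIcc_subset hμ hx)).intervalIntegrable
  set G : ℝ → ℝ := fun t => F (1 / 2 + t * (μ - 1 / 2)) with hG
  have hmaps : ∀ t ∈ Icc (-1 : ℝ) 1, 1 / 2 + t * (μ - 1 / 2) ∈ Ioo (0 : ℝ) 1 := fun t ht => by
    have h1 : |μ - 1 / 2| < 1 / 2 := abs_lt.2 ⟨by linarith [hμ.1], by linarith [hμ.2]⟩
    have h2 : |t * (μ - 1 / 2)| ≤ |μ - 1 / 2| := by
      rw [abs_mul]
      exact mul_le_of_le_one_left (abs_nonneg _) (abs_le.2 ht)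
    have h3 := abs_lt.1 (h2.trans_lt h1)
    exact ⟨by linarith [h3.1], by linarith [h3.2]⟩
  have heven : ∀ t, G (-t) = G t := fun t => by
    simp only [hG]
    rw [← hsymm]; congr 1; ring
  have hmono : ∀ s t : ℝ, 0 ≤ s → s ≤ t → t ≤ 1 → G s ≤ G t := by
    intro s t hs hst ht
    rcases hs.eq_or_lt with rfl | hs0
    · have := hF2 (hmaps (-t) ⟨by linarith, by linarith⟩) (hmaps t ⟨by linarith, ht⟩)
        (a := 1 / 2) (b := 1 / 2) (by norm_num) (by norm_num) (by norm_num)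
      simp only [smul_eq_mul] at this
      have e : (1 / 2 * (1 / 2 + -t * (μ - 1 / 2)) + 1 / 2 * (1 / 2 + t * (μ - 1 / 2)) : ℝ)
        = 1 / 2 + 0 * (μ - 1 / 2) := by ring
      rw [e] at this
      have := heven t
      simp only [hG] at *
      linarith
    · have ht0 : 0 < t := hs0.trans_le hst
      have := hF2 (hmaps (-t) ⟨by linarith, by linarith⟩) (hmaps t ⟨by linarith, ht⟩)
        (a := (t - s) / (2 * t)) (b := (t + s) / (2 * t)) (by apply div_nonneg <;> linarith)
        (by positivity) (by field_simp; ring)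
      simp only [smul_eq_mul] at this
      have e : ((t - s) / (2 * t) * (1 / 2 + -t * (μ - 1 / 2))
          + (t + s) / (2 * t) * (1 / 2 + t * (μ - 1 / 2)) : ℝ) = 1 / 2 + s * (μ - 1 / 2) := by
        field_simp; ring
      rw [e] at this
      refine this.trans (le_of_eq ?_)
      have h1 : F (1 / 2 + -t * (μ - 1 / 2)) = G t := heven t
      rw [h1]
      change _ * G t + _ * G t = G t
      field_simp; ring
  have hGc : ContinuousOn G (Icc 0 1) := hcont.comp (by fun_prop) fun t ht =>
    hmaps t ⟨by linarith [ht.1], ht.2⟩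
  have hmean : ∃ ξ ∈ Ioo (0 : ℝ) 1, G ξ = intervalMean F μ (1 - μ) := by
    -- Here `G` is constant, so any interior `ξ` serves.
    by_cases h : μ = 1 / 2
    · refine ⟨1 / 2, by norm_num, ?_⟩
      subst h
      simp only [hG, intervalMean]; norm_num
    · obtain ⟨ξ, hξ, e⟩ := exists_eq_interval_average (f := G) (a := 0) (b := 1) zero_ne_one
        (by rwa [uIcc_of_le zero_le_one])
      refine ⟨ξ, by rwa [uIoo_of_le zero_le_one] at hξ, ?_⟩
      rw [e, intervalMean_eq hsymm h (hint _ (by norm_num)), interval_average_eq]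
      simp [hG]
  refine ⟨hint _ hμ', ?_⟩
  obtain ⟨ξ, hξ, e⟩ := hmean
  have hT : ∀ t, mapT F t μ (1 - μ) = G t := fun t => mapT_eq hsymm t μ
  have h0 : F (1 / 2) = G 0 := by simp [hG]
  have h1 : F μ = G 1 := by simp [hG]
  refine ⟨ξ, hξ, (hT ξ).trans e, fun η hη l hl => ?_⟩
  rw [hT, hT, hT, h0, h1]
  exact ⟨hmono _ _ le_rfl hη.1 (by linarith [hη.2, hξ.2]), hmono _ _ hη.1 hη.2 hξ.2.le,
    hmono _ _ hξ.1.le hl.1 hl.2, hmono _ _ (by linarith [hl.1, hξ.1]) hl.2 le_rfl⟩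

/-! ### Ideal estimates and dissipativity for unitarily invariant norms -/

namespace UnitarilyInvariantNorm

open Filter Complex

variable {H : Type*} [NormedAddCommGroup H] [InnerProductSpace ℂ H] [CompleteSpace H]
  (N : UnitarilyInvariantNorm H) {S T Z : H →L[ℂ] H}

theorem smul_mem (c : ℂ) (hS : S ∈ N.ideal) : c • S ∈ N.ideal := by
  simpa using N.ideal.mul_mem_left (c • 1) S hS

theorem mul_mul_mem (C D : H →L[ℂ] H) (hS : S ∈ N.ideal) : C * S * D ∈ N.ideal :=
  N.ideal.mul_mem_right _ _ (N.ideal.mul_mem_left _ _ hS)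

theorem norm_zero : N.norm 0 = 0 := by
  simpa using N.norm_smul 0 0 N.ideal.zero_mem

theorem norm_neg (hS : S ∈ N.ideal) : N.norm (-S) = N.norm S := by
  simpa using N.norm_smul (-1) S hS

theorem norm_sub_le (hS : S ∈ N.ideal) (hT : T ∈ N.ideal) :
    N.norm (S - T) ≤ N.norm S + N.norm T := by
  rw [sub_eq_add_neg, ← N.norm_neg hT]
  exact N.norm_add_le _ hS _ (N.ideal.neg_mem hT)

theorem norm_nonneg (hS : S ∈ N.ideal) : 0 ≤ N.norm S := by
  have := N.norm_sub_le hS hS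
  rw [sub_self, N.norm_zero] at this
  linarith

theorem norm_le_norm_add_norm_sub (hS : S ∈ N.ideal) (hT : T ∈ N.ideal) :
    N.norm S ≤ N.norm T + N.norm (S - T) := by
  simpa using N.norm_add_le _ hT _ (N.ideal.sub_mem hS hT)

theorem norm_real_smul {c : ℝ} (hc : 0 ≤ c) (hS : S ∈ N.ideal) :
    N.norm ((c : ℂ) • S) = c * N.norm S := by
  rw [N.norm_smul _ _ hS, norm_real, Real.norm_of_nonneg hc]

theorem norm_unitary_mul {U : H →L[ℂ] H} (hU : U ∈ unitary (H →L[ℂ] H)) (hS : S ∈ N.ideal) :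
    N.norm (U * S) = N.norm S := by
  simpa using N.norm_unitary_mul_mul_unitary U hU 1 (one_mem _) S hS

theorem norm_mul_unitary {U : H →L[ℂ] H} (hU : U ∈ unitary (H →L[ℂ] H)) (hS : S ∈ N.ideal) :
    N.norm (S * U) = N.norm S := by
  simpa using N.norm_unitary_mul_mul_unitary 1 (one_mem _) U hU S hS

theorem norm_sum_le {ι : Type*} (s : Finset ι) (f : ι → H →L[ℂ] H) (hf : ∀ i ∈ s, f i ∈ N.ideal) :
    N.norm (∑ i ∈ s, f i) ≤ ∑ i ∈ s, N.norm (f i) := by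
  classical
  induction s using Finset.induction_on with
  | empty => simp [N.norm_zero]
  | insert i s hi ih =>
    rw [Finset.sum_insert hi, Finset.sum_insert hi]
    have h := fun j hj => hf j (Finset.mem_insert_of_mem hj)
    exact (N.norm_add_le _ (hf i (Finset.mem_insert_self _ _)) _
      (N.ideal.finsetSum_mem s f h)).trans (by gcongr; exact ih h)

/-- An operator is a combination of four unitaries with coefficients of modulus at most `‖C‖ / 2`.
The constant is not sharp, but it suffices for continuity. -/
theorem norm_mul_left_le (C : H →L[ℂ] H) (hS : S ∈ N.ideal) :
    N.norm (C * S) ≤ 2 * ‖C‖ * N.norm S := by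
  obtain ⟨u, c, h, hc⟩ := CStarAlgebra.exists_sum_four_unitary C
  have hmem : ∀ i, (u i : H →L[ℂ] H) * S ∈ N.ideal := fun i => N.ideal.mul_mem_left _ _ hS
  calc N.norm (C * S) = N.norm (∑ i, c i • ((u i : H →L[ℂ] H) * S)) := by
        conv_lhs => rw [h, Finset.sum_mul]
        simp only [smul_mul_assoc]
    _ ≤ ∑ i, N.norm (c i • ((u i : H →L[ℂ] H) * S)) :=
        N.norm_sum_le _ _ fun i _ => N.smul_mem _ (hmem i)
    _ ≤ ∑ _i : Fin 4, ‖C‖ / 2 * N.norm S := by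
        gcongr with i
        rw [N.norm_smul _ _ (hmem i), N.norm_unitary_mul (u i).2 hS]
        exact mul_le_mul_of_nonneg_right (hc i) (N.norm_nonneg hS)
    _ = 2 * ‖C‖ * N.norm S := by simp; ring

theorem norm_mul_right_le (C : H →L[ℂ] H) (hS : S ∈ N.ideal) :
    N.norm (S * C) ≤ 2 * ‖C‖ * N.norm S := by
  obtain ⟨u, c, h, hc⟩ := CStarAlgebra.exists_sum_four_unitary C
  have hmem : ∀ i, S * (u i : H →L[ℂ] H) ∈ N.ideal := fun i => N.ideal.mul_mem_right _ _ hS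
  calc N.norm (S * C) = N.norm (∑ i, c i • (S * (u i : H →L[ℂ] H))) := by
        conv_lhs => rw [h, Finset.mul_sum]
        simp only [mul_smul_comm]
    _ ≤ ∑ i, N.norm (c i • (S * (u i : H →L[ℂ] H))) :=
        N.norm_sum_le _ _ fun i _ => N.smul_mem _ (hmem i)
    _ ≤ ∑ _i : Fin 4, ‖C‖ / 2 * N.norm S := by
        gcongr with i
        rw [N.norm_smul _ _ (hmem i), N.norm_mul_unitary (u i).2 hS]
        exact mul_le_mul_of_nonneg_right (hc i) (N.norm_nonneg hS)
    _ = 2 * ‖C‖ * N.norm S := by simp; ring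

theorem norm_mul_mul_le (C D : H →L[ℂ] H) (hS : S ∈ N.ideal) :
    N.norm (C * S * D) ≤ 4 * ‖C‖ * ‖D‖ * N.norm S := by
  have h1 := N.norm_mul_right_le D (N.ideal.mul_mem_left C S hS)
  have h2 := mul_le_mul_of_nonneg_left (N.norm_mul_left_le C hS) (by positivity : 0 ≤ 2 * ‖D‖)
  linarith

/-- Multiplication by a selfadjoint contraction on the left does not increase the norm. -/
theorem norm_mul_left_le_of_isSelfAdjoint {C : H →L[ℂ] H} (hC : IsSelfAdjoint C) (hC1 : ‖C‖ ≤ 1)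
    (hS : S ∈ N.ideal) : N.norm (C * S) ≤ N.norm S := by
  -- `C` is the average of the unitaries `U` and `star U`, which gives the sharp constant 1.
  set U := C + I • CFC.sqrt (1 - C ^ 2)
  have hU : U ∈ unitary (H →L[ℂ] H) := hC.self_add_I_smul_cfcSqrt_sub_sq_mem_unitary C hC1
  have hs : star U = C - I • CFC.sqrt (1 - C ^ 2) := by
    have hsq := (CFC.sqrt_nonneg (1 - C ^ 2)).isSelfAdjoint.star_eq
    simp only [U, star_add, star_smul, hsq, hC.star_eq]
    simp [sub_eq_add_neg]
  have h2 : (2 : ℂ) • (C * S) = U * S + star U * S := by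
    rw [hs, two_smul, ← add_mul, ← add_mul]; congr 1; simp only [U]; abel
  have h := N.norm_add_le _ (N.ideal.mul_mem_left U S hS) _ (N.ideal.mul_mem_left (star U) S hS)
  rw [← h2, N.norm_smul _ _ (N.ideal.mul_mem_left _ _ hS), N.norm_unitary_mul hU hS,
    N.norm_unitary_mul (Unitary.star_mem hU) hS] at h
  simp at h
  linarith

/-- Multiplication by a selfadjoint contraction on the right does not increase the norm. -/
theorem norm_mul_right_le_of_isSelfAdjoint {C : H →L[ℂ] H} (hC : IsSelfAdjoint C) (hC1 : ‖C‖ ≤ 1)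
    (hS : S ∈ N.ideal) : N.norm (S * C) ≤ N.norm S := by
  set U := C + I • CFC.sqrt (1 - C ^ 2)
  have hU : U ∈ unitary (H →L[ℂ] H) := hC.self_add_I_smul_cfcSqrt_sub_sq_mem_unitary C hC1
  have hs : star U = C - I • CFC.sqrt (1 - C ^ 2) := by
    have hsq := (CFC.sqrt_nonneg (1 - C ^ 2)).isSelfAdjoint.star_eq
    simp only [U, star_add, star_smul, hsq, hC.star_eq]
    simp [sub_eq_add_neg]
  have h2 : (2 : ℂ) • (S * C) = S * U + S * star U := by
    rw [hs, two_smul, ← mul_add, ← mul_add]; congr 1; simp only [U]; abel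
  have h := N.norm_add_le _ (N.ideal.mul_mem_right S U hS) _ (N.ideal.mul_mem_right S (star U) hS)
  rw [← h2, N.norm_smul _ _ (N.ideal.mul_mem_right _ _ hS), N.norm_mul_unitary hU hS,
    N.norm_mul_unitary (Unitary.star_mem hU) hS] at h
  simp at h
  linarith

section Tendsto

variable {ι : Type*} {l : Filter ι} {C D E G : ι → H →L[ℂ] H} {C₀ D₀ E₀ G₀ : H →L[ℂ] H}

theorem tendsto_norm_mul_mul_sub (hS : S ∈ N.ideal) (hC : Tendsto C l (𝓝 C₀))
    (hD : Tendsto D l (𝓝 D₀)) :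
    Tendsto (fun i => N.norm (C i * S * D i - C₀ * S * D₀)) l (𝓝 0) := by
  have hlim : Tendsto (fun i => 4 * ‖C i - C₀‖ * ‖D i‖ * N.norm S
      + 4 * ‖C₀‖ * ‖D i - D₀‖ * N.norm S) l (𝓝 0) := by
    have h1 : Tendsto (fun i => ‖C i - C₀‖) l (𝓝 0) := tendsto_iff_norm_sub_tendsto_zero.1 hC
    have h2 : Tendsto (fun i => ‖D i - D₀‖) l (𝓝 0) := tendsto_iff_norm_sub_tendsto_zero.1 hD
    simpa using (((h1.const_mul 4).mul hD.norm).mul_const (N.norm S)).add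
      ((h2.const_mul (4 * ‖C₀‖)).mul_const (N.norm S))
  refine squeeze_zero (fun i => N.norm_nonneg (N.ideal.sub_mem (N.mul_mul_mem _ _ hS)
    (N.mul_mul_mem _ _ hS))) (fun i => ?_) hlim
  have e : C i * S * D i - C₀ * S * D₀ = (C i - C₀) * S * D i + C₀ * S * (D i - D₀) := by
    noncomm_ring
  rw [e]
  exact (N.norm_add_le _ (N.mul_mul_mem _ _ hS) _ (N.mul_mul_mem _ _ hS)).trans
    (add_le_add (N.norm_mul_mul_le _ _ hS) (N.norm_mul_mul_le _ _ hS))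

theorem tendsto_norm_sub_of_two_terms (hS : S ∈ N.ideal) (hC : Tendsto C l (𝓝 C₀))
    (hD : Tendsto D l (𝓝 D₀)) (hE : Tendsto E l (𝓝 E₀)) (hG : Tendsto G l (𝓝 G₀)) :
    Tendsto (fun i => N.norm (C i * S * D i + E i * S * G i - (C₀ * S * D₀ + E₀ * S * G₀)))
      l (𝓝 0) := by
  have h := (N.tendsto_norm_mul_mul_sub hS hC hD).add (N.tendsto_norm_mul_mul_sub hS hE hG)
  rw [add_zero] at h
  have hm : ∀ P Q P' Q' : H →L[ℂ] H, P * S * Q - P' * S * Q' ∈ N.ideal := fun P Q P' Q' =>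
    N.ideal.sub_mem (N.mul_mul_mem _ _ hS) (N.mul_mul_mem _ _ hS)
  refine squeeze_zero (fun i => N.norm_nonneg ?_) (fun i => ?_) h
  · rw [add_sub_add_comm]
    exact N.ideal.add_mem (hm _ _ _ _) (hm _ _ _ _)
  · rw [add_sub_add_comm]
    exact N.norm_add_le _ (hm _ _ _ _) _ (hm _ _ _ _)

theorem tendsto_norm_of_two_terms (hS : S ∈ N.ideal) (hC : Tendsto C l (𝓝 C₀))
    (hD : Tendsto D l (𝓝 D₀)) (hE : Tendsto E l (𝓝 E₀)) (hG : Tendsto G l (𝓝 G₀)) :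
    Tendsto (fun i => N.norm (C i * S * D i + E i * S * G i)) l
      (𝓝 (N.norm (C₀ * S * D₀ + E₀ * S * G₀))) := by
  have hm : ∀ P Q P' Q' : H →L[ℂ] H, P * S * Q + P' * S * Q' ∈ N.ideal := fun P Q P' Q' =>
    N.ideal.add_mem (N.mul_mul_mem _ _ hS) (N.mul_mul_mem _ _ hS)
  rw [tendsto_iff_dist_tendsto_zero]
  refine squeeze_zero (fun _ => dist_nonneg) (fun i => ?_)
    (N.tendsto_norm_sub_of_two_terms hS hC hD hE hG)
  rw [Real.dist_eq, abs_sub_le_iff]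
  have h1 := N.norm_le_norm_add_norm_sub (hm (C i) (D i) (E i) (G i)) (hm C₀ D₀ E₀ G₀)
  refine ⟨by linarith only [h1], ?_⟩
  have := N.norm_le_norm_add_norm_sub (hm C₀ D₀ E₀ G₀) (hm (C i) (D i) (E i) (G i))
  rw [← neg_sub, N.norm_neg (N.ideal.sub_mem (hm _ _ _ _) (hm _ _ _ _))] at this
  linarith

end Tendsto

theorem exp_smul_I_smul_mem_unitary {a : H →L[ℂ] H} (ha : IsSelfAdjoint a) (s : ℝ) :
    NormedSpace.exp (s • (I • a)) ∈ unitary (H →L[ℂ] H) := by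
  have h : IsSelfAdjoint (s • a) := (IsSelfAdjoint.all s).smul ha
  have := (selfAdjoint.expUnitary ⟨s • a, h⟩).2
  rw [selfAdjoint.expUnitary_coe] at this
  rwa [smul_comm]

theorem tendsto_inv_smul_exp_smul_sub_one (a : H →L[ℂ] H) :
    Tendsto (fun s : ℝ => s⁻¹ • (NormedSpace.exp (s • a) - 1)) (𝓝[>] 0) (𝓝 a) := by
  have h := (hasDerivAt_exp_smul_const a (0 : ℝ)).tendsto_slope_zero_right
  simpa using h

theorem tendsto_exp_smul (a : H →L[ℂ] H) :
    Tendsto (fun s : ℝ => NormedSpace.exp (s • a)) (𝓝[>] 0) (𝓝 1) := by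
  have h := (hasDerivAt_exp_smul_const a (0 : ℝ)).continuousAt.tendsto
  simp only [zero_smul, NormedSpace.exp_zero] at h
  exact h.mono_left nhdsWithin_le_nhds

/-- The generator of the group `Z ↦ exp (i s a) Z exp (-i s b)` of isometries is dissipative. -/
theorem norm_le_norm_add_I_smul_commutator {a b : H →L[ℂ] H} (ha : IsSelfAdjoint a)
    (hb : IsSelfAdjoint b) (hZ : Z ∈ N.ideal) :
    N.norm Z ≤ N.norm (Z + I • (a * Z - Z * b)) := by
  set D := I • (a * Z - Z * b) with hD
  have hDm : D ∈ N.ideal := N.smul_mem _ (N.ideal.sub_mem (N.ideal.mul_mem_left _ _ hZ)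
    (N.ideal.mul_mem_right _ _ hZ))
  have hZD := N.ideal.add_mem hZ hDm
  set U : ℝ → H →L[ℂ] H := fun s => NormedSpace.exp (s • (I • a)) with hU
  set V : ℝ → H →L[ℂ] H := fun s => NormedSpace.exp (s • (I • -b)) with hV
  set u : ℝ → H →L[ℂ] H := fun s => s⁻¹ • (U s - 1) with hu
  set v : ℝ → H →L[ℂ] H := fun s => s⁻¹ • (V s - 1) with hv
  have hr := N.tendsto_norm_sub_of_two_terms hZ (tendsto_inv_smul_exp_smul_sub_one (I • a))
    (tendsto_exp_smul (I • -b)) (tendsto_const_nhds (x := (1 : H →L[ℂ] H)))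
    (tendsto_inv_smul_exp_smul_sub_one (I • -b))
  have hD' : (I • a) * Z * 1 + 1 * Z * (I • -b) = D := by
    simp [hD, sub_eq_add_neg]
  rw [hD'] at hr
  have hlim := (tendsto_const_nhds (x := N.norm (Z + D))).add hr
  rw [add_zero] at hlim
  refine ge_of_tendsto hlim ?_
  filter_upwards [Ioo_mem_nhdsGT (zero_lt_one (α := ℝ))] with s hs
  set R := u s * Z * V s + 1 * Z * v s with hR
  have hRm : R ∈ N.ideal := N.ideal.add_mem (N.mul_mul_mem _ _ hZ) (N.mul_mul_mem _ _ hZ)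
  change N.norm Z ≤ N.norm (Z + D) + N.norm (R - D)
  have hUs : U s = 1 + (s : ℂ) • u s := by
    simp only [hu, coe_smul, smul_inv_smul₀ hs.1.ne']; abel
  have hVs : V s = 1 + (s : ℂ) • v s := by
    simp only [hv, coe_smul, smul_inv_smul₀ hs.1.ne']; abel
  have hUZV : U s * Z * V s = Z + (s : ℂ) • R := by
    have : U s * Z * V s = Z * V s + (s : ℂ) • (u s * Z * V s) := by
      conv_lhs => rw [hUs]
      simp [add_mul]
    rw [this, hR]
    conv_lhs => enter [1]; rw [hVs]
    simp [mul_add, smul_add]; abel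
  have h1 : N.norm (Z + (s : ℂ) • R) = N.norm Z := by
    rw [← hUZV]
    exact N.norm_unitary_mul_mul_unitary _ (exp_smul_I_smul_mem_unitary ha s) _
      (exp_smul_I_smul_mem_unitary hb.neg s) _ hZ
  -- The left side is the isometric image of `Z`. The triangle inequality and division by `s` leave
  -- only the error `R - D`, which vanishes as `s → 0`.
  have h2 : Z + (s : ℂ) • R = ((1 - s : ℝ) : ℂ) • Z + (s : ℂ) • (Z + D) + (s : ℂ) • (R - D) := by
    push_cast; module
  have h3 : N.norm Z ≤ (1 - s) * N.norm Z + s * N.norm (Z + D) + s * N.norm (R - D) := by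
    have hRD := N.ideal.sub_mem hRm hDm
    rw [← N.norm_real_smul (sub_nonneg.2 hs.2.le) hZ, ← N.norm_real_smul hs.1.le hZD,
      ← N.norm_real_smul hs.1.le hRD, ← h1, h2]
    have hZD' := N.smul_mem s hZD
    have hZ' := N.smul_mem ((1 - s : ℝ) : ℂ) hZ
    refine (N.norm_add_le _ (N.ideal.add_mem hZ' hZD') _ (N.smul_mem _ hRD)).trans ?_
    gcongr
    exact N.norm_add_le _ hZ' _ hZD'
  have h4 : s * N.norm Z ≤ s * (N.norm (Z + D) + N.norm (R - D)) := by linarith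
  exact le_of_mul_le_mul_left h4 hs.1

theorem commutator_mem (a b : H →L[ℂ] H) (hZ : Z ∈ N.ideal) : a * Z - Z * b ∈ N.ideal :=
  N.ideal.sub_mem (N.ideal.mul_mem_left _ _ hZ) (N.ideal.mul_mem_right _ _ hZ)

/-- Factor `1 + δ² = (1 - iδ)(1 + iδ)` and use dissipativity for `(a, b)` and `(-a, -b)`. -/
theorem norm_le_norm_add_commutator_sq {a b : H →L[ℂ] H} (ha : IsSelfAdjoint a)
    (hb : IsSelfAdjoint b) (hZ : Z ∈ N.ideal) :
    N.norm Z ≤ N.norm (Z + (a * (a * Z - Z * b) - (a * Z - Z * b) * b)) := by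
  refine (N.norm_le_norm_add_I_smul_commutator ha hb hZ).trans ?_
  refine (N.norm_le_norm_add_I_smul_commutator ha.neg hb.neg
    (N.ideal.add_mem hZ (N.smul_mem I (N.commutator_mem a b hZ)))).trans (le_of_eq ?_)
  congr 1
  simp only [neg_mul, mul_neg, mul_add, add_mul, mul_smul_comm, smul_mul_assoc, smul_sub, smul_add,
    smul_neg, smul_smul, I_mul_I, mul_sub, sub_mul]
  module

theorem norm_commutator_le {a b : H →L[ℂ] H} {M : ℝ} (ha : ‖a‖ ≤ M) (hb : ‖b‖ ≤ M)
    (hZ : Z ∈ N.ideal) : N.norm (a * Z - Z * b) ≤ 4 * M * N.norm Z := by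
  have h0 := N.norm_nonneg hZ
  have h1 := N.norm_mul_left_le a hZ
  have h2 := N.norm_mul_right_le b hZ
  have h3 := N.norm_sub_le (N.ideal.mul_mem_left a _ hZ) (N.ideal.mul_mem_right _ b hZ)
  nlinarith [mul_le_mul_of_nonneg_right ha h0, mul_le_mul_of_nonneg_right hb h0]

/-- A quantitative form of the arithmetic-geometric mean inequality
`2 |||Z||| ≤ |||P Z Q⁻¹ + P⁻¹ Z Q|||` for `P = 1 + h a` and `Q = 1 + h b` close to `1`. -/
theorem two_mul_norm_sub_le {a b P P' Q Q' : H →L[ℂ] H} {h M : ℝ} (ha : IsSelfAdjoint a)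
    (hb : IsSelfAdjoint b) (haM : ‖a‖ ≤ M) (hbM : ‖b‖ ≤ M) (hP : P = 1 + (h : ℂ) • a)
    (hQ : Q = 1 + (h : ℂ) • b) (hPP' : P * P' = 1) (hQQ' : Q' * Q = 1)
    (hZ : Z ∈ N.ideal) :
    2 * N.norm Z - h ^ 2 * ((4 * M) ^ 2 * N.norm (P' * Z * Q' - Z)) ≤
      N.norm (P * Z * Q' + P' * Z * Q) := by
  have hM : 0 ≤ M := (_root_.norm_nonneg _).trans haM
  set Y := P' * Z * Q' with hY
  have hYm : Y ∈ N.ideal := N.mul_mul_mem _ _ hZ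
  set δ : (H →L[ℂ] H) → (H →L[ℂ] H) := fun W => a * (a * W - W * b) - (a * W - W * b) * b with hδ
  have hδm : ∀ W ∈ N.ideal, δ W ∈ N.ideal := fun W hW =>
    N.commutator_mem _ _ (N.commutator_mem _ _ hW)
  have hPY : P * Z * Q' + P' * Z * Q = P * (P * Y) + Y * Q * Q := by
    have h1 : P * Y = Z * Q' := by rw [hY, mul_assoc, ← mul_assoc P, hPP', one_mul]
    have h2 : Y * Q = P' * Z := by rw [hY, mul_assoc, hQQ', mul_one]
    rw [h1, h2, mul_assoc]
  have hZY : Z = P * Y * Q := by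
    have h1 : P * Y = Z * Q' := by rw [hY, mul_assoc, ← mul_assoc P, hPP', one_mul]
    rw [h1, mul_assoc, hQQ', mul_one]
  -- This is `P²Y + YQ² - 2PYQ = h² δ Y`, where the linear terms in `h` cancel.
  have key : P * Z * Q' + P' * Z * Q = (2 : ℂ) • Z + ((h ^ 2 : ℝ) : ℂ) • δ Y := by
    rw [hPY]
    conv_rhs => enter [1, 2]; rw [hZY]
    simp only [hδ, hP, hQ, mul_add, add_mul, mul_sub, sub_mul, one_mul, mul_one, mul_smul_comm,
      smul_mul_assoc, smul_add, smul_sub, smul_smul, mul_assoc]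
    push_cast
    module
  have hlow : 2 * N.norm Z ≤ N.norm ((2 : ℂ) • Z + ((h ^ 2 : ℝ) : ℂ) • δ Z) := by
    -- After the factor 2 is pulled out, the coefficient of `δ Z` is `h² / 2 = r²`.
    set r : ℝ := h / √2 with hr
    have hr2 : r * r = h ^ 2 / 2 := by
      rw [hr, div_mul_div_comm, Real.mul_self_sqrt (by norm_num)]; ring
    have h1 := N.norm_le_norm_add_commutator_sq ((IsSelfAdjoint.all r).smul ha)
      ((IsSelfAdjoint.all r).smul hb) hZ
    have h2 : (2 : ℂ) • Z + ((h ^ 2 : ℝ) : ℂ) • δ Z = (2 : ℂ) • (Z + ((r • a) * ((r • a) * Z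
        - Z * (r • b)) - ((r • a) * Z - Z * (r • b)) * (r • b))) := by
      have h3 : ((h ^ 2 : ℝ) : ℂ) = 2 * (r * r : ℝ) := by rw [hr2]; push_cast; ring
      rw [h3]
      simp only [hδ, smul_mul_assoc, mul_smul_comm, ← smul_sub, smul_smul, smul_add, ← coe_smul,
        ofReal_mul]
    rw [h2, N.norm_smul _ _ (N.ideal.add_mem hZ (N.commutator_mem _ _ (N.commutator_mem _ _ hZ)))]
    simpa using h1
  have hdiff : N.norm (δ (Y - Z)) ≤ (4 * M) ^ 2 * N.norm (Y - Z) := by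
    have hYZ := N.ideal.sub_mem hYm hZ
    have h1 := N.norm_commutator_le haM hbM (N.commutator_mem a b hYZ)
    have h2 := mul_le_mul_of_nonneg_left (N.norm_commutator_le haM hbM hYZ)
      (by positivity : 0 ≤ 4 * M)
    refine h1.trans (h2.trans (le_of_eq (by ring)))
  have hsplit : (2 : ℂ) • Z + ((h ^ 2 : ℝ) : ℂ) • δ Z - ((2 : ℂ) • Z + ((h ^ 2 : ℝ) : ℂ) • δ Y)
      = -(((h ^ 2 : ℝ) : ℂ) • δ (Y - Z)) := by
    have : δ (Y - Z) = δ Y - δ Z := by simp only [hδ]; noncomm_ring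
    rw [this]; module
  have hδYZ := hδm _ (N.ideal.sub_mem hYm hZ)
  have hmem : ∀ W ∈ N.ideal, (2 : ℂ) • Z + ((h ^ 2 : ℝ) : ℂ) • δ W ∈ N.ideal := fun W hW =>
    N.ideal.add_mem (N.smul_mem _ hZ) (N.smul_mem _ (hδm W hW))
  have hfin := N.norm_le_norm_add_norm_sub (hmem Z hZ) (hmem Y hYm)
  rw [hsplit, N.norm_neg (N.smul_mem _ hδYZ), N.norm_real_smul (sq_nonneg h) hδYZ] at hfin
  rw [key]
  have := mul_le_mul_of_nonneg_left hdiff (sq_nonneg h)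
  linarith

end UnitarilyInvariantNorm

/-! ### Powers and resolvent cut-offs of positive operators -/

section Powers

open Filter

variable {H : Type*} [NormedAddCommGroup H] [InnerProductSpace ℂ H] [CompleteSpace H]
  {A : H →L[ℂ] H}

theorem IsStrictlyPositive.rpow_eq_exp_smul_log (hA : IsStrictlyPositive A) (s : ℝ) :
    A ^ s = NormedSpace.exp (s • CFC.log A) := by
  have hpos : ∀ x ∈ spectrum ℝ A, 0 < x := fun x hx => by grind
  have hlog : ContinuousOn Real.log (spectrum ℝ A) :=
    Real.continuousOn_log.mono fun x hx => (hpos x hx).ne'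
  have hsa : IsSelfAdjoint (s • CFC.log A) := (IsSelfAdjoint.all s).smul IsSelfAdjoint.log
  rw [← CFC.real_exp_eq_normedSpace_exp hsa, CFC.log, ← cfc_smul s _ A,
    ← cfc_comp' Real.exp (fun x => s • Real.log x) A, CFC.rpow_eq_cfc_real hA.nonneg]
  refine cfc_congr fun x hx => ?_
  simp only [smul_eq_mul]
  rw [Real.rpow_def_of_pos (hpos x hx), mul_comm]

theorem IsStrictlyPositive.continuous_rpow (hA : IsStrictlyPositive A) :
    Continuous fun s : ℝ => A ^ s := by
  simp only [hA.rpow_eq_exp_smul_log]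
  have : Continuous (NormedSpace.exp : (H →L[ℂ] H) → H →L[ℂ] H) := by
    let _ : NormedAlgebra ℚ (H →L[ℂ] H) := .restrictScalars ℚ ℂ _
    exact NormedSpace.exp_continuous
  exact this.comp (by fun_prop)

theorem tendsto_add_smul_one_rpow (hA : 0 ≤ A) {ν : ℝ} (hν : 0 < ν) :
    Tendsto (fun δ : ℝ => (A + δ • (1 : H →L[ℂ] H)) ^ ν) (𝓝[>] 0) (𝓝 (A ^ ν)) := by
  lift ν to NNReal using hν.le
  have hν' : 0 < ν := by exact_mod_cast hν
  simp only [← CFC.nnrpow_eq_rpow hν']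
  refine (CFC.continuousOn_nnrpow ν A hA).tendsto.comp (tendsto_nhdsWithin_iff.2 ⟨?_, ?_⟩)
  · have : Continuous fun δ : ℝ => A + δ • (1 : H →L[ℂ] H) := by fun_prop
    simpa using (this.tendsto 0).mono_left nhdsWithin_le_nhds
  · filter_upwards [self_mem_nhdsWithin] with δ hδ
    exact add_nonneg hA (smul_nonneg (le_of_lt hδ) zero_le_one)

theorem isStrictlyPositive_add_smul_one (hA : 0 ≤ A) {δ : ℝ} (hδ : 0 < δ) :
    IsStrictlyPositive (A + δ • (1 : H →L[ℂ] H)) :=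
  IsStrictlyPositive.nonneg_add hA (IsStrictlyPositive.smul hδ isStrictlyPositive_one)

/-- The resolvent cut-off `A (A + δ)⁻¹`. -/
noncomputable def resolventCutoff (A : H →L[ℂ] H) (δ : ℝ) : H →L[ℂ] H :=
  cfc (fun x : ℝ => x / (x + δ)) A

theorem continuousOn_div_add_spectrum (hA : 0 ≤ A) {δ : ℝ} (hδ : 0 < δ) {f : ℝ → ℝ}
    (hf : Continuous f) : ContinuousOn (fun x : ℝ => f x / (x + δ)) (spectrum ℝ A) :=
  hf.continuousOn.div (by fun_prop) fun x hx => by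
    have : 0 ≤ x := spectrum_nonneg_of_nonneg hA hx
    positivity

theorem isSelfAdjoint_resolventCutoff (δ : ℝ) : IsSelfAdjoint (resolventCutoff A δ) :=
  cfc_predicate _ _

theorem norm_resolventCutoff_le_one (hA : 0 ≤ A) {δ : ℝ} (hδ : 0 < δ) :
    ‖resolventCutoff A δ‖ ≤ 1 := by
  refine norm_cfc_le zero_le_one fun x hx => ?_
  have : 0 ≤ x := spectrum_nonneg_of_nonneg hA hx
  rw [Real.norm_of_nonneg (by positivity)]
  exact div_le_one_of_le₀ (by linarith) (by positivity)

theorem commute_resolventCutoff_rpow (hA : 0 ≤ A) (δ ν : ℝ) :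
    Commute (resolventCutoff A δ) (A ^ ν) := by
  rw [CFC.rpow_eq_cfc_real hA]
  exact cfc_commute_cfc _ _ A

/-- Splitting off a half power lets the compression of `X` by cut-offs factor through `A^(1/2) X
B^(1/2)`, which is in the ideal even if `X` is not. -/
theorem exists_resolventCutoff_eq_mul_rpow_half (hA : 0 ≤ A) {δ : ℝ} (hδ : 0 < δ) :
    ∃ k : H →L[ℂ] H, resolventCutoff A δ = k * A ^ (1 / 2 : ℝ) ∧
      resolventCutoff A δ = A ^ (1 / 2 : ℝ) * k := by
  refine ⟨cfc (fun x : ℝ => √x / (x + δ)) A, ?_⟩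
  have h : resolventCutoff A δ = cfc (fun x : ℝ => √x / (x + δ)) A * A ^ (1 / 2 : ℝ) := by
    rw [CFC.rpow_eq_cfc_real hA, ← cfc_mul _ _ A
      (continuousOn_div_add_spectrum hA hδ Real.continuous_sqrt)
      (Real.continuous_rpow_const (by norm_num)).continuousOn]
    refine cfc_congr fun x hx => ?_
    have : 0 ≤ x := spectrum_nonneg_of_nonneg hA hx
    simp only [← Real.sqrt_eq_rpow]
    rw [div_mul_eq_mul_div, Real.mul_self_sqrt this]
  refine ⟨h, h.trans ?_⟩
  rw [CFC.rpow_eq_cfc_real hA]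
  exact cfc_commute_cfc _ _ A

/-- On the spectrum the error is `δ x^ν / (x + δ) ≤ δ^ν`, uniformly in `x ≥ 0`. -/
theorem tendsto_resolventCutoff_mul_rpow (hA : 0 ≤ A) {ν : ℝ} (hν : ν ∈ Ioo (0 : ℝ) 1) :
    Tendsto (fun δ : ℝ => resolventCutoff A δ * A ^ ν) (𝓝[>] 0) (𝓝 (A ^ ν)) := by
  rw [tendsto_iff_norm_sub_tendsto_zero]
  have hlim : Tendsto (fun δ : ℝ => δ ^ ν) (𝓝[>] 0) (𝓝 0) := by
    have := (Real.continuous_rpow_const hν.1.le).tendsto 0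
    rw [Real.zero_rpow hν.1.ne'] at this
    exact this.mono_left nhdsWithin_le_nhds
  refine squeeze_zero' (.of_forall fun _ => norm_nonneg _) ?_ hlim
  filter_upwards [self_mem_nhdsWithin] with δ (hδ : 0 < δ)
  have hp : ContinuousOn (fun x : ℝ => x ^ ν) (spectrum ℝ A) :=
    (Real.continuous_rpow_const hν.1.le).continuousOn
  have hd : ContinuousOn (fun x : ℝ => x / (x + δ)) (spectrum ℝ A) :=
    continuousOn_div_add_spectrum hA hδ continuous_id
  have hm : ContinuousOn (fun x : ℝ => x / (x + δ) * x ^ ν) (spectrum ℝ A) := hd.mul hp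
  rw [CFC.rpow_eq_cfc_real hA, resolventCutoff, ← cfc_mul _ _ A hd hp,
    ← cfc_sub _ _ A hm hp]
  refine norm_cfc_le (by positivity) fun x hx => ?_
  have hx : 0 ≤ x := spectrum_nonneg_of_nonneg hA hx
  have e : x / (x + δ) * x ^ ν - x ^ ν = -(δ * x ^ ν / (x + δ)) := by
    have : x + δ ≠ 0 := by positivity
    field_simp; ring
  rw [e, norm_neg, Real.norm_of_nonneg (by positivity), div_le_iff₀ (by positivity)]
  have h1 : x ^ ν ≤ (x + δ) ^ ν := Real.rpow_le_rpow hx (by linarith) hν.1.le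
  have h2 : δ ^ (1 - ν) ≤ (x + δ) ^ (1 - ν) :=
    Real.rpow_le_rpow hδ.le (by linarith) (by linarith [hν.2])
  have h3 : δ = δ ^ ν * δ ^ (1 - ν) := by rw [← Real.rpow_add hδ]; simp
  have h4 : x + δ = (x + δ) ^ (1 - ν) * (x + δ) ^ ν := by
    rw [← Real.rpow_add (by positivity)]; simp
  calc δ * x ^ ν = δ ^ ν * (δ ^ (1 - ν) * x ^ ν) := by rw [← mul_assoc, ← h3]
    _ ≤ δ ^ ν * ((x + δ) ^ (1 - ν) * (x + δ) ^ ν) := by gcongr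
    _ = δ ^ ν * (x + δ) := by rw [← h4]

end Powers

/-! ### Convexity of the Heinz norm -/

section Heinz

open Filter

variable {H : Type*} [NormedAddCommGroup H] [InnerProductSpace ℂ H] [CompleteSpace H]
  {A B X : H →L[ℂ] H} (N : UnitarilyInvariantNorm H)

theorem heinzOperator_mem (hX : X ∈ N.ideal) (ν : ℝ) : heinzOperator A B X ν ∈ N.ideal :=
  N.ideal.add_mem (N.mul_mul_mem _ _ hX) (N.mul_mul_mem _ _ hX)

theorem heinzOperator_one_sub (ν : ℝ) : heinzOperator A B X (1 - ν) = heinzOperator A B X ν := by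
  rw [heinzOperator, heinzOperator, sub_sub_cancel, add_comm]

theorem heinzOperator_add_heinzOperator (hA : IsStrictlyPositive A) (hB : IsStrictlyPositive B)
    (ν t : ℝ) :
    heinzOperator A B X (ν + t) + heinzOperator A B X (ν - t) =
      A ^ t * heinzOperator A B X ν * B ^ (-t) + A ^ (-t) * heinzOperator A B X ν * B ^ t := by
  simp only [heinzOperator, mul_add, add_mul]
  have hl : ∀ s r : ℝ, ∀ W, A ^ s * (A ^ r * W) = A ^ (s + r) * W := fun s r W => by
    rw [CFC.rpow_add hA.isUnit, mul_assoc]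
  have hr : ∀ s r : ℝ, B ^ s * B ^ r = B ^ (s + r) := fun s r => by
    rw [CFC.rpow_add hB.isUnit]
  simp only [mul_assoc, hl, hr]
  ring_nf
  abel

theorem convexOn_heinzNorm_of_isStrictlyPositive (hA : IsStrictlyPositive A)
    (hB : IsStrictlyPositive B) (hX : X ∈ N.ideal) :
    ConvexOn ℝ (Ioo 0 1) (heinzNorm N A B X) := by
  refine convexOn_Ioo_of_second_difference (Continuous.continuousOn ?_) fun x _ ε hε => ?_
  · have hA' := hA.continuous_rpow
    have hB' := hB.continuous_rpow
    have h1 : Continuous fun ν : ℝ => 1 - ν := by fun_prop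
    exact continuous_iff_continuousAt.2 fun ν => N.tendsto_norm_of_two_terms hX
      (hA'.tendsto ν) ((hB'.comp h1).tendsto ν) ((hA'.comp h1).tendsto ν) (hB'.tendsto ν)
  set Z := heinzOperator A B X x
  have hZ : Z ∈ N.ideal := heinzOperator_mem N hX x
  have hquot : ∀ {C : H →L[ℂ] H}, IsStrictlyPositive C →
      ∀ᶠ t : ℝ in 𝓝[>] 0, ‖t⁻¹ • (C ^ t - 1)‖ ≤ ‖CFC.log C‖ + 1 := fun {C} hC => by
    have h := (UnitarilyInvariantNorm.tendsto_inv_smul_exp_smul_sub_one (CFC.log C)).norm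
    simp only [← hC.rpow_eq_exp_smul_log] at h
    exact h.eventually_le_const (lt_add_one _)
  have hneg : ∀ {C : H →L[ℂ] H}, IsStrictlyPositive C →
      Tendsto (fun t : ℝ => C ^ (-t)) (𝓝[>] 0) (𝓝 1) := fun {C} hC => by
    have := (hC.continuous_rpow.comp continuous_neg).tendsto 0
    simp only [Function.comp_apply, neg_zero, CFC.rpow_zero C hC.nonneg] at this
    exact this.mono_left nhdsWithin_le_nhds
  -- The quotients `(A^t - 1) / t` and `(B^t - 1) / t` tend to the logarithms, so `M` bounds both
  -- for all small `t`.
  set M := max (‖CFC.log A‖ + 1) (‖CFC.log B‖ + 1)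
  have hsmall : ∀ᶠ t : ℝ in 𝓝[>] 0, (4 * M) ^ 2 * N.norm (A ^ (-t) * Z * B ^ (-t) - Z) ≤ ε := by
    have h := (N.tendsto_norm_mul_mul_sub hZ (hneg hA) (hneg hB)).const_mul ((4 * M) ^ 2)
    simp only [one_mul, mul_one, mul_zero] at h
    exact h.eventually_le_const hε
  filter_upwards [hquot hA, hquot hB, hsmall, self_mem_nhdsWithin] with t hat hbt hst ht
  have ht0 : t ≠ 0 := ne_of_gt ht
  have hsa : ∀ C : H →L[ℂ] H, IsSelfAdjoint (t⁻¹ • (C ^ t - 1)) := fun C =>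
    (IsSelfAdjoint.all _).smul ((CFC.rpow_nonneg).isSelfAdjoint.sub (.one _))
  have hone : ∀ C : H →L[ℂ] H, C ^ t = 1 + (t : ℂ) • (t⁻¹ • (C ^ t - 1)) := fun C => by
    rw [Complex.coe_smul, smul_inv_smul₀ ht0]; abel
  have key := N.two_mul_norm_sub_le (M := M) (hsa A) (hsa B) (hat.trans (le_max_left _ _))
    (hbt.trans (le_max_right _ _)) (hone A) (hone B) (CFC.rpow_mul_rpow_neg t hA)
    (CFC.rpow_neg_mul_rpow t hB) hZ
  rw [← heinzOperator_add_heinzOperator hA hB] at key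
  have h1 := N.norm_add_le _ (heinzOperator_mem (A := A) (B := B) N hX (x + t)) _
    (heinzOperator_mem (A := A) (B := B) N hX (x - t))
  have h2 := mul_le_mul_of_nonneg_left hst (sq_nonneg t)
  simp only [heinzNorm]
  linarith

theorem convexOn_heinzNorm_of_mem (hA : 0 ≤ A) (hB : 0 ≤ B) (hX : X ∈ N.ideal) :
    ConvexOn ℝ (Ioo 0 1) (heinzNorm N A B X) := by
  refine ConvexOn.of_tendsto (l := 𝓝[>] (0 : ℝ)) (f := fun δ => heinzNorm N
    (A + δ • (1 : H →L[ℂ] H)) (B + δ • (1 : H →L[ℂ] H)) X) (convex_Ioo 0 1) ?_ fun x hx => ?_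
  · filter_upwards [self_mem_nhdsWithin] with δ hδ
    exact convexOn_heinzNorm_of_isStrictlyPositive N (isStrictlyPositive_add_smul_one hA hδ)
      (isStrictlyPositive_add_smul_one hB hδ) hX
  · have hx' : 0 < 1 - x := by linarith [hx.2]
    exact N.tendsto_norm_of_two_terms hX (tendsto_add_smul_one_rpow hA hx.1)
      (tendsto_add_smul_one_rpow hB hx') (tendsto_add_smul_one_rpow hA hx')
      (tendsto_add_smul_one_rpow hB hx.1)

theorem heinzOperator_half :
    heinzOperator A B X (1 / 2) = (2 : ℂ) • (A ^ (1 / 2 : ℝ) * X * B ^ (1 / 2 : ℝ)) := by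
  rw [heinzOperator, two_smul]; norm_num

theorem rpow_half_mul_mul_rpow_half_mem (h : heinzOperator A B X (1 / 2) ∈ N.ideal) :
    A ^ (1 / 2 : ℝ) * X * B ^ (1 / 2 : ℝ) ∈ N.ideal := by
  rw [heinzOperator_half] at h
  simpa [smul_smul] using N.smul_mem (2⁻¹ : ℂ) h

theorem heinzOperator_resolventCutoff (hA : 0 ≤ A) (hB : 0 ≤ B) (δ ν : ℝ) :
    heinzOperator A B (resolventCutoff A δ * X * resolventCutoff B δ) ν =
      resolventCutoff A δ * heinzOperator A B X ν * resolventCutoff B δ := by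
  have h1 := fun s : ℝ => (commute_resolventCutoff_rpow hA δ s).eq
  have h2 := fun s : ℝ => (commute_resolventCutoff_rpow hB δ s).eq
  simp only [heinzOperator, mul_add, add_mul, ← mul_assoc, ← h1]
  simp only [mul_assoc, h2]

theorem convexOn_heinzNorm_of_lowerSemicontinuousOn (hA : 0 ≤ A) (hB : 0 ≤ B)
    (hN : LowerSemicontinuousOn N.norm {S | S ∈ N.ideal})
    (hX : ∀ ν ∈ Ioo (0 : ℝ) 1, heinzOperator A B X ν ∈ N.ideal) :
    ConvexOn ℝ (Ioo 0 1) (heinzNorm N A B X) := by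
  have hhalf := rpow_half_mul_mul_rpow_half_mem N (hX (1 / 2) (by norm_num))
  refine ConvexOn.of_tendsto (l := 𝓝[>] (0 : ℝ)) (f := fun δ => heinzNorm N A B
    (resolventCutoff A δ * X * resolventCutoff B δ)) (convex_Ioo 0 1) ?_ fun x hx => ?_
  · filter_upwards [self_mem_nhdsWithin] with δ hδ
    refine convexOn_heinzNorm_of_mem N hA hB ?_
    obtain ⟨k, hk, -⟩ := exists_resolventCutoff_eq_mul_rpow_half hA hδ
    obtain ⟨m, -, hm⟩ := exists_resolventCutoff_eq_mul_rpow_half hB hδ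
    have := N.mul_mul_mem k m hhalf
    rw [hk, hm]
    simpa only [mul_assoc] using this
  have hx' : 1 - x ∈ Ioo (0 : ℝ) 1 := ⟨by linarith [hx.2], by linarith [hx.1]⟩
  simp only [heinzNorm, heinzOperator_resolventCutoff hA hB]
  have hright : ∀ {s : ℝ}, s ∈ Ioo (0 : ℝ) 1 →
      Tendsto (fun δ : ℝ => B ^ s * resolventCutoff B δ) (𝓝[>] 0) (𝓝 (B ^ s)) := fun hs => by
    simpa only [(commute_resolventCutoff_rpow hB _ _).eq] using tendsto_resolventCutoff_mul_rpow hB hs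
  have hop : Tendsto (fun δ : ℝ => resolventCutoff A δ * heinzOperator A B X x *
      resolventCutoff B δ) (𝓝[>] 0) (𝓝 (heinzOperator A B X x)) := by
    have h := (((tendsto_resolventCutoff_mul_rpow hA hx).mul_const X).mul (hright hx')).add
      (((tendsto_resolventCutoff_mul_rpow hA hx').mul_const X).mul (hright hx))
    refine h.congr fun δ => ?_
    simp only [heinzOperator, mul_add, add_mul, mul_assoc]
  -- Convergence holds only in operator norm. Lower semicontinuity bounds the norms from below, and
  -- contractivity of the cut-offs, with constant exactly 1, from above.
  rw [tendsto_order]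
  refine ⟨fun y hy => ?_, fun y hy => ?_⟩
  · refine (tendsto_nhdsWithin_iff.2 ⟨hop, .of_forall fun δ => ?_⟩).eventually
      (hN _ (hX x hx) y hy)
    exact N.mul_mul_mem _ _ (hX x hx)
  · filter_upwards [self_mem_nhdsWithin] with δ hδ
    refine lt_of_le_of_lt ?_ hy
    exact (N.norm_mul_right_le_of_isSelfAdjoint (isSelfAdjoint_resolventCutoff δ)
      (norm_resolventCutoff_le_one hB hδ) (N.ideal.mul_mem_left _ _ (hX x hx))).trans
      (N.norm_mul_left_le_of_isSelfAdjoint (isSelfAdjoint_resolventCutoff δ)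
      (norm_resolventCutoff_le_one hA hδ) (hX x hx))

end Heinz

theorem theorem3p5 {H : Type*} [NormedAddCommGroup H] [InnerProductSpace ℂ H] [CompleteSpace H]
    [TopologicalSpace.SeparableSpace H]
    (A B X : H →L[ℂ] H) (hA : 0 ≤ A) (hB : 0 ≤ B)
    (N : UnitarilyInvariantNorm H)
    (hX : X ∈ N.ideal ∨
      (LowerSemicontinuousOn N.norm {S | S ∈ N.ideal} ∧
        ∀ ν ∈ Ioo (0 : ℝ) 1, heinzOperator A B X ν ∈ N.ideal))
    (μ : ℝ) (hμ : μ ∈ Ioo (0 : ℝ) 1) :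
    IntervalIntegrable (heinzNorm N A B X) volume μ (1 - μ) ∧
    ∃ ξ ∈ Ioo (0 : ℝ) 1,
      mapT (heinzNorm N A B X) ξ μ (1 - μ) = intervalMean (heinzNorm N A B X) μ (1 - μ) ∧
      ∀ η ∈ Icc 0 ξ, ∀ l ∈ Icc ξ 1,
        2 * N.norm (A ^ (1 / 2 : ℝ) * X * B ^ (1 / 2 : ℝ)) ≤
          mapT (heinzNorm N A B X) η μ (1 - μ) ∧
        mapT (heinzNorm N A B X) η μ (1 - μ) ≤ mapT (heinzNorm N A B X) ξ μ (1 - μ) ∧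
        mapT (heinzNorm N A B X) ξ μ (1 - μ) ≤ mapT (heinzNorm N A B X) l μ (1 - μ) ∧
        mapT (heinzNorm N A B X) l μ (1 - μ) ≤ heinzNorm N A B X μ := by
  have hconv : ConvexOn ℝ (Ioo 0 1) (heinzNorm N A B X) := hX.elim
    (convexOn_heinzNorm_of_mem N hA hB)
    fun h => convexOn_heinzNorm_of_lowerSemicontinuousOn N hA hB h.1 h.2
  have hmem : heinzOperator A B X (1 / 2) ∈ N.ideal := hX.elim
    (fun h => heinzOperator_mem N h _) fun h => h.2 _ (by norm_num)
  have hhalf : 2 * N.norm (A ^ (1 / 2 : ℝ) * X * B ^ (1 / 2 : ℝ)) = heinzNorm N A B X (1 / 2) := by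
    rw [heinzNorm, heinzOperator_half, N.norm_smul _ _ (rpow_half_mul_mul_rpow_half_mem N hmem)]
    simp
  rw [hhalf]
  exact hermiteHadamard_of_symm hconv
    (fun x => congrArg N.norm (heinzOperator_one_sub x)) hμ
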